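/- Write $\lg=\log_2$. A source is a vector $q=(q_1,\dots,q_n)$ with $q_1\ge\dots\ge q_n>0$ and $\sum_i q_i=1$. Let $\mathcal L_n$ be the set of vectors $l=(l_1,\dots,l_n)$ of positive integers with $\sum_{i=1}^n 2^{-l_i}\le 1$ (the codeword lengths of binary prefix codes). Define $$\bar R(l,q)=\sum_i q_i(l_i+\lg q_i),\qquad R^d(q,l)=\frac1d\lg\sum_i q_i^{1+d}2^{dl_i},\qquad L_a(q,l)=\log_a\sum_i q_i a^{l_i},$$ and let $\bar R_{\mathrm{opt}}(q)$, $R^d_{\mathrm{opt}}(q)$, $L_a^{\mathrm{opt}}(q)$ be their minima over $l\in\mathcal L_n$. Let $H_\alpha(q)=\frac1{1-\alpha}\lg\sum_i q_i^\alpha$ be the Rényi entropy. For $x\in(0,1)$ put $H(x)=-x\lg x-(1-x)\lg(1-x)$ and $$\bar o(x)=\xi-(1-x)\lg(2^{\xi}-1)-H(x),\qquad \xi=\left\lceil\lg\frac{1-2^{1/(x-1)}}{1-2^{x/(x-1)}}\right\rceil,$$ $$\omega^*(x)=\max\left(1+\lg\frac{1-x}{1-2^{-\lambda}},\ \lambda+\lg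 x\right),\qquad \lambda=\lceil-\lg x\rceil.$$ Let $\bar\omega(x)$ be the supremum of $\bar R_{\mathrm{opt}}(q)$ over all sources $q$ (of any size) with $q_1=x$, and let $\bar\omega'(x)$ be the supremum of $\bar R_{\mathrm{opt}}(q)$ over all sources $q$ in which some symbol has probability $x$. Then, for all $x\in(0,1)$, $\bar o(x)\ge 0$, $\omega^*(x)\le1$, $\bar\omega(x)\le1$ and $\bar\omega'(x)\le 1$. Moreover, let $n\ge2$, let $p=(p_1,\dots,p_n)$ be a source, let $a>\frac12$ with $a\ne1$, and put $\tilde\alpha=\frac1{1+\lg a}$ and $\hat p_i=p_i^{\tilde\alpha}/\sum_k p_k^{\tilde\alpha}$. Then: 1. $\hat p$ is a source, $\hat p_j=p_j^{\tilde\alpha}2^{(\tilde\alpha-1)H_{\tilde\alpha}(p)}$ for every $j$, $R^{\lg a}(\hat p,l)=L_a(p,l)-H_{\tilde\alpha}(p)$ for every $l\in\mathcal L_n$, and hence $R^{\lg a}_{\mathrm{opt}}(\hat p)=L_a^{\mathrm{opt}}(p)-H_{\tilde\alpha}(p)$. 2. If $a>1$, then for every $j$ $$\bar o(\hat p_j)\le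 L_a^{\mathrm{opt}}(p)-H_{\tilde\alpha}(p)\le\omega^*(\hat p_j).$$ 3. If $\frac12<a<1$, then $$0\le L_a^{\mathrm{opt}}(p)-H_{\tilde\alpha}(p)\le\bar\omega(\hat p_1)\quad\text{and}\quad 0\le L_a^{\mathrm{opt}}(p)-H_{\tilde\alpha}(p)\le\bar\omega'(\hat p_j)\ \text{ for every } j.$$ The same upper bounds hold with $\bar\omega$ replaced by any function $\omega$ that satisfies $\bar R_{\mathrm{opt}}(q)\le\omega(q_1)$ for all sources $q$ with at least two symbols, and with $\bar\omega'$ replaced by any function $\omega'$ that satisfies $\bar R_{\mathrm{opt}}(q)\le\omega'(q_i)$ for all such $q$ and all $i$. -/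

import Mathlib

noncomputable section

namespace ExpCoding

/-- The binary logarithm. -/
def lg (x : ℝ) : ℝ := Real.logb 2 x

/-- A source on the alphabet `{1, …, n}`: positive probabilities with sum `1`, in nonincreasing
order.  The symbol `1` of the alphabet is the index `0`. -/
structure IsSource {n : ℕ} (p : Fin n → ℝ) : Prop where
  pos : ∀ i, 0 < p i
  sum_eq_one : ∑ i, p i = 1
  antitone : Antitone p

/-- The codeword length vectors of binary prefix codes: vectors of positive integers that satisfy
the Kraft inequality. -/
def lengthVectors (n : ℕ) : Set (Fin n → ℕ) :=
  {l | (∀ i, 0 < l i) ∧ ∑ i, (2 : ℝ)⁻¹ ^ l i ≤ 1}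

/-- Average redundancy `∑ᵢ pᵢ (lᵢ + lg pᵢ)`. -/
def avgRed {n : ℕ} (p : Fin n → ℝ) (l : Fin n → ℕ) : ℝ :=
  ∑ i, p i * ((l i : ℝ) + lg (p i))

/-- Optimal average redundancy (the redundancy of Huffman coding).  For a source, the values form
a nonempty set that is bounded below by `0`. -/
def avgRedOpt {n : ℕ} (p : Fin n → ℝ) : ℝ :=
  sInf (avgRed p '' lengthVectors n)

/-- `d`-th exponential redundancy `(1/d) lg ∑ᵢ pᵢ^(1+d) 2^(d lᵢ)`. -/
def expRed (d : ℝ) {n : ℕ} (p : Fin n → ℝ) (l : Fin n → ℕ) : ℝ :=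
  1 / d * lg (∑ i, p i ^ (1 + d) * (2 : ℝ) ^ (d * (l i : ℝ)))

/-- Optimal `d`-th exponential redundancy. -/
def expRedOpt (d : ℝ) {n : ℕ} (p : Fin n → ℝ) : ℝ :=
  sInf (expRed d p '' lengthVectors n)

/-- Exponential-average cost `log_a ∑ᵢ pᵢ a^lᵢ`. -/
def expCost (a : ℝ) {n : ℕ} (p : Fin n → ℝ) (l : Fin n → ℕ) : ℝ :=
  Real.logb a (∑ i, p i * a ^ l i)

/-- Optimal exponential-average cost.  For a source and `a > 0`, `a ≠ 1`, the costs form a nonempty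
set that is bounded below by `0`. -/
def expCostOpt (a : ℝ) {n : ℕ} (p : Fin n → ℝ) : ℝ :=
  sInf (expCost a p '' lengthVectors n)

/-- Rényi entropy in bits, of order `α > 0`, `α ≠ 1`. -/
def renyi (α : ℝ) {n : ℕ} (p : Fin n → ℝ) : ℝ :=
  1 / (1 - α) * lg (∑ i, p i ^ α)

/-- The order `1 / (1 + lg a)` of the Rényi entropy that belongs to the base `a`. -/
def order (a : ℝ) : ℝ := 1 / (1 + lg a)

/-- The transformed distribution, with probabilities proportional to `pᵢ ^ order a`. -/
def tilt (a : ℝ) {n : ℕ} (p : Fin n → ℝ) (i : Fin n) : ℝ :=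
  p i ^ order a / ∑ k, p k ^ order a

/-- The binary entropy function, in bits. -/
def binH (x : ℝ) : ℝ := -x * lg x - (1 - x) * lg (1 - x)

/-- The integer `ξ` that occurs in the lower bound on average redundancy, for `x ∈ (0,1)`. -/
def xi (x : ℝ) : ℤ :=
  ⌈lg ((1 - (2 : ℝ) ^ (1 / (x - 1))) / (1 - (2 : ℝ) ^ (x / (x - 1))))⌉

/-- The lower bound on optimal average redundancy, given that `x ∈ (0,1)` is the probability of
some symbol. -/
def oBar (x : ℝ) : ℝ :=
  (xi x : ℝ) - (1 - x) * lg ((2 : ℝ) ^ xi x - 1) - binH x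

/-- The upper bound on optimal maximum pointwise redundancy, given that `x ∈ (0,1)` is the
probability of some symbol; here `⌈-lg x⌉` is the length of its Shannon codeword. -/
def omegaStar (x : ℝ) : ℝ :=
  max (1 + lg ((1 - x) / (1 - (2 : ℝ) ^ (-⌈-lg x⌉)))) ((⌈-lg x⌉ : ℝ) + lg x)

/-- The optimal average redundancies of all sources whose largest probability is `x`. -/
def avgRedGivenMax (x : ℝ) : Set ℝ :=
  {r | ∃ (m : ℕ) (hm : 0 < m) (q : Fin m → ℝ), IsSource q ∧ q ⟨0, hm⟩ = x ∧ r = avgRedOpt q}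

/-- The optimal average redundancies of all sources in which some symbol has probability `x`. -/
def avgRedGivenSome (x : ℝ) : Set ℝ :=
  {r | ∃ (m : ℕ) (j : Fin m) (q : Fin m → ℝ), IsSource q ∧ q j = x ∧ r = avgRedOpt q}

/-- The best upper bound on optimal average redundancy in terms of the largest probability. -/
def omegaBar (x : ℝ) : ℝ := sSup (avgRedGivenMax x)

/-- The best upper bound on optimal average redundancy in terms of the probability of an arbitrary
symbol. -/
def omegaBar' (x : ℝ) : ℝ := sSup (avgRedGivenSome x)

/-- `ω` is an upper bound on optimal average redundancy in terms of the largest probability. -/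
def IsUpperBoundGivenMax (ω : ℝ → ℝ) : Prop :=
  ∀ x ∈ Set.Ioo (0 : ℝ) 1, ω x ∈ upperBounds (avgRedGivenMax x)

/-- `ω` is an upper bound on optimal average redundancy in terms of the probability of an arbitrary
symbol. -/
def IsUpperBoundGivenSome (ω : ℝ → ℝ) : Prop :=
  ∀ x ∈ Set.Ioo (0 : ℝ) 1, ω x ∈ upperBounds (avgRedGivenSome x)

end ExpCoding

end

open ExpCoding

/-!
The map `p ↦ tilt a p` turns exponential-average cost into exponential redundancy with parameter
`d = lg a`, up to the additive constant `renyi (order a) p`, since `order a * (1 + d) = 1`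
(`expRed_tilt`). It remains to bound `expRedOpt d q` for a source `q` and `d > -1`, `d ≠ 0`.

By Jensen's inequality for the logarithm, `d * avgRed q l ≤ d * expRed d q l`
(`mul_avgRed_le_mul_expRed`), so exponential redundancy dominates average redundancy for `d > 0` and
is dominated by it for `d < 0`.

* For `d > 0` the lower bound reduces to average redundancy. With `k = l j` and `x = q j`, the
  log-sum inequality on the symbols other than `j` together with the Kraft inequality bounds
  `avgRed q l` below by the divergence of `(x, 1 - x)` from `(2⁻ᵏ, 1 - 2⁻ᵏ)`. As a function of
  `k ≥ 1` that divergence is smallest at `k = xi x`, where it equals `oBar x`; as a divergence it is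
  nonnegative.
* For `d > 0` the upper bound comes from the code that gives symbol `j` its Shannon length and
  distributes the remaining Kraft sum over the other symbols in proportion to their probabilities:
  all its pointwise redundancies are at most `omegaStar (q j)`, hence so is `expRed d q`.
* For `d < 0` the lower bound `0` is Hölder's inequality, and the upper bounds are bounds on
  `avgRedOpt q`, which is at most `1` by the Shannon code.
-/

noncomputable section

namespace ExpCoding

/-! ### The binary logarithm -/

lemma lg_mul {x y : ℝ} (hx : 0 < x) (hy : 0 < y) : lg (x * y) = lg x + lg y :=
  Real.logb_mul hx.ne' hy.ne'

lemma lg_div {x y : ℝ} (hx : 0 < x) (hy : 0 < y) : lg (x / y) = lg x - lg y :=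
  Real.logb_div hx.ne' hy.ne'

lemma lg_rpow {x : ℝ} (hx : 0 < x) (r : ℝ) : lg (x ^ r) = r * lg x :=
  Real.logb_rpow_eq_mul_logb_of_pos hx

lemma lg_two_rpow (r : ℝ) : lg ((2 : ℝ) ^ r) = r :=
  Real.logb_rpow (by norm_num) (by norm_num)

lemma two_rpow_lg {x : ℝ} (hx : 0 < x) : (2 : ℝ) ^ lg x = x :=
  Real.rpow_logb (by norm_num) (by norm_num) hx

lemma lg_two_pow (k : ℕ) : lg ((2 : ℝ) ^ k) = k := by
  rw [← Real.rpow_natCast, lg_two_rpow]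

lemma lg_le_lg {x y : ℝ} (hx : 0 < x) (h : x ≤ y) : lg x ≤ lg y :=
  Real.logb_le_logb_of_le (by norm_num) hx h

lemma lg_one : lg 1 = 0 := Real.logb_one

lemma lg_pos {x : ℝ} (hx : 1 < x) : 0 < lg x := Real.logb_pos (by norm_num) hx

lemma lg_neg {x : ℝ} (h0 : 0 < x) (h1 : x < 1) : lg x < 0 :=
  Real.logb_neg (by norm_num) h0 h1

/-- Jensen's inequality for the binary logarithm. -/
lemma sum_mul_lg_le {ι : Type*} (s : Finset ι) (w y : ι → ℝ) (hw : ∀ i ∈ s, 0 ≤ w i)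
    (hw1 : ∑ i ∈ s, w i = 1) (hy : ∀ i ∈ s, 0 < y i) :
    ∑ i ∈ s, w i * lg (y i) ≤ lg (∑ i ∈ s, w i * y i) := by
  have h := strictConcaveOn_log_Ioi.concaveOn.le_map_sum hw hw1 (p := y) hy
  simp only [smul_eq_mul] at h
  have h2 : (0 : ℝ) < Real.log 2 := Real.log_pos (by norm_num)
  simp only [lg, Real.logb, mul_div_assoc', ← Finset.sum_div]
  gcongr

/-- The log-sum inequality. -/
lemma le_sum_mul_lg_div {ι : Type*} (s : Finset ι) (hs : s.Nonempty) (w r : ι → ℝ)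
    (hw : ∀ i ∈ s, 0 < w i) (hr : ∀ i ∈ s, 0 < r i) :
    (∑ i ∈ s, w i) * lg ((∑ i ∈ s, w i) / ∑ i ∈ s, r i) ≤ ∑ i ∈ s, w i * lg (w i / r i) := by
  have hW : 0 < ∑ i ∈ s, w i := Finset.sum_pos hw hs
  have hR : 0 < ∑ i ∈ s, r i := Finset.sum_pos hr hs
  set W := ∑ i ∈ s, w i with hWdef
  have h := sum_mul_lg_le s (fun i => w i / W) (fun i => r i / w i)
    (fun i hi => (div_pos (hw i hi) hW).le) (by rw [← Finset.sum_div, div_self hW.ne'])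
    (fun i hi => div_pos (hr i hi) (hw i hi))
  have e1 : ∑ i ∈ s, w i / W * (r i / w i) = (∑ i ∈ s, r i) / W := by
    rw [Finset.sum_div]
    refine Finset.sum_congr rfl fun i hi => ?_
    have := (hw i hi).ne'
    field_simp
  have e2 : ∑ i ∈ s, w i / W * lg (r i / w i) = -(∑ i ∈ s, w i * lg (w i / r i)) / W := by
    rw [← Finset.sum_neg_distrib, Finset.sum_div]
    refine Finset.sum_congr rfl fun i hi => ?_
    rw [lg_div (hr i hi) (hw i hi), lg_div (hw i hi) (hr i hi)]
    ring
  rw [e1, e2, div_le_iff₀ hW, lg_div hR hW] at h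
  rw [lg_div hW hR]
  linarith

/-! ### The lower bound on average redundancy -/

/-- The divergence of the distribution `(x, 1 - x)` from `(2⁻ᵏ, 1 - 2⁻ᵏ)`, in the form in which
`oBar` is written. It bounds the average redundancy of a code from below if a symbol of probability
`x` has a codeword of length `k`. -/
def redGivenLength (x : ℝ) (k : ℕ) : ℝ := (k : ℝ) - (1 - x) * lg ((2 : ℝ) ^ k - 1) - binH x

lemma two_pow_sub_one_pos {k : ℕ} (hk : 0 < k) : (0 : ℝ) < 2 ^ k - 1 := by
  have : (1 : ℝ) < 2 ^ k := one_lt_pow₀ (by norm_num) hk.ne'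
  linarith

lemma inv_two_pow_lt_one {k : ℕ} (hk : 0 < k) : (2 : ℝ)⁻¹ ^ k < 1 :=
  pow_lt_one₀ (by norm_num) (by norm_num) hk.ne'

lemma redGivenLength_eq {x : ℝ} (hx : x ∈ Set.Ioo (0 : ℝ) 1) {k : ℕ} (hk : 0 < k) :
    redGivenLength x k =
      x * lg (x / (2 : ℝ)⁻¹ ^ k) + (1 - x) * lg ((1 - x) / (1 - (2 : ℝ)⁻¹ ^ k)) := by
  have h2 : (0 : ℝ) < 2 ^ k := by positivity
  have e : 1 - (2 : ℝ)⁻¹ ^ k = (2 ^ k - 1) / 2 ^ k := by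
    rw [inv_pow]; field_simp
  have hx1 : 0 < 1 - x := by linarith [hx.2]
  have hp := two_pow_sub_one_pos hk
  rw [e, lg_div hx1 (div_pos hp h2), lg_div hp h2, inv_pow, div_inv_eq_mul, lg_mul hx.1 h2,
    lg_two_pow, redGivenLength, binH]
  ring

lemma redGivenLength_nonneg {x : ℝ} (hx : x ∈ Set.Ioo (0 : ℝ) 1) {k : ℕ} (hk : 0 < k) :
    0 ≤ redGivenLength x k := by
  have h0 : (0 : ℝ) < (2 : ℝ)⁻¹ ^ k := by positivity
  have h1 := inv_two_pow_lt_one hk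
  have h := le_sum_mul_lg_div Finset.univ Finset.univ_nonempty
    ![x, 1 - x] ![(2 : ℝ)⁻¹ ^ k, 1 - (2 : ℝ)⁻¹ ^ k]
    (by intro i _; fin_cases i <;> simp [hx.1, hx.2])
    (by intro i _; fin_cases i <;> simp; simpa using h1)
  simp only [Fin.sum_univ_two, Matrix.cons_val_zero, Matrix.cons_val_one, add_sub_cancel,
    div_one, lg_one, mul_zero] at h
  rw [redGivenLength_eq hx hk]
  exact h

lemma xi_pos {x : ℝ} (hx : x ∈ Set.Ioo (0 : ℝ) 1) : 0 < xi x := by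
  have hx1 : x - 1 < 0 := by linarith [hx.2]
  refine Int.ceil_pos.2 (lg_pos ?_)
  have h1 : (2 : ℝ) ^ (x / (x - 1)) < 1 :=
    Real.rpow_lt_one_of_one_lt_of_neg (by norm_num) (div_neg_of_pos_of_neg hx.1 hx1)
  have h2 : (2 : ℝ) ^ (1 / (x - 1)) < (2 : ℝ) ^ (x / (x - 1)) :=
    Real.rpow_lt_rpow_of_exponent_lt (by norm_num) (div_lt_div_of_neg_of_lt hx1 hx.2)
  rw [one_lt_div (by linarith)]
  linarith

/-- `xi x` is the least positive `k` for which
`redGivenLength x k ≤ redGivenLength x (k + 1)`. This is the threshold condition behind that. -/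
lemma xi_le_iff {x : ℝ} (hx : x ∈ Set.Ioo (0 : ℝ) 1) (k : ℕ) :
    xi x ≤ k ↔ (2 ^ (k + 1) - 1) * (2 : ℝ) ^ (1 / (x - 1)) ≤ 2 ^ k - 1 := by
  have hx1 : x - 1 < 0 := by linarith [hx.2]
  have h1 : (2 : ℝ) ^ (x / (x - 1)) < 1 :=
    Real.rpow_lt_one_of_one_lt_of_neg (by norm_num) (div_neg_of_pos_of_neg hx.1 hx1)
  have e : (2 : ℝ) ^ (x / (x - 1)) = 2 * (2 : ℝ) ^ (1 / (x - 1)) := by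
    have : x / (x - 1) = 1 + 1 / (x - 1) := by field_simp [hx1.ne]; ring
    rw [this, Real.rpow_add (by norm_num), Real.rpow_one]
  have hd : 0 < 1 - (2 : ℝ) ^ (x / (x - 1)) := by linarith
  have hn : 0 < 1 - (2 : ℝ) ^ (1 / (x - 1)) := by
    have : (2 : ℝ) ^ (1 / (x - 1)) < 1 :=
      Real.rpow_lt_one_of_one_lt_of_neg (by norm_num) (div_neg_of_pos_of_neg one_pos hx1)
    linarith
  rw [xi, Int.ceil_le, lg, Real.logb_le_iff_le_rpow (by norm_num) (div_pos hn hd), div_le_iff₀ hd,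
    Int.cast_natCast, Real.rpow_natCast, e, pow_succ]
  constructor <;> intro h <;> nlinarith

/-- The increment of `redGivenLength x` has the sign dictated by the threshold inequality of
`xi_le_iff`, since `2 ^ (1 / (x - 1))` has logarithm `-1 / (1 - x)`. -/
lemma redGivenLength_succ_sub {x : ℝ} (hx : x ∈ Set.Ioo (0 : ℝ) 1) (k : ℕ) :
    redGivenLength x (k + 1) - redGivenLength x k =
      (1 - x) * (lg (2 ^ k - 1) - lg ((2 ^ (k + 1) - 1) * (2 : ℝ) ^ (1 / (x - 1)))) := by
  have hx1 : x - 1 ≠ 0 := by linarith [hx.2]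
  rw [lg_mul (two_pow_sub_one_pos k.succ_pos) (by positivity), lg_two_rpow, redGivenLength,
    redGivenLength]
  push_cast
  field_simp
  ring

lemma oBar_eq {x : ℝ} (hx : x ∈ Set.Ioo (0 : ℝ) 1) : oBar x = redGivenLength x (xi x).toNat := by
  have h : ((xi x).toNat : ℤ) = xi x := Int.toNat_of_nonneg (xi_pos hx).le
  rw [oBar, redGivenLength, ← zpow_natCast, ← Int.cast_natCast, h]

lemma oBar_nonneg {x : ℝ} (hx : x ∈ Set.Ioo (0 : ℝ) 1) : 0 ≤ oBar x := by
  rw [oBar_eq hx]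
  exact redGivenLength_nonneg hx (by have := xi_pos hx; omega)

/-- Among all lengths, `xi x` minimizes the lower bound `redGivenLength x`. -/
lemma oBar_le_redGivenLength {x : ℝ} (hx : x ∈ Set.Ioo (0 : ℝ) 1) {k : ℕ} (hk : 0 < k) :
    oBar x ≤ redGivenLength x k := by
  have hxi := xi_pos hx
  have hx1 : 0 < 1 - x := by linarith [hx.2]
  rw [oBar_eq hx]
  rcases le_total (xi x).toNat k with h | h
  · induction k, h using Nat.le_induction with
    | base => rfl
    | succ m hm ih =>
      have hm0 : 0 < m := by omega
      refine (ih hm0).trans (sub_nonneg.1 ?_)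
      rw [redGivenLength_succ_sub hx m]
      refine mul_nonneg hx1.le (sub_nonneg.2 (lg_le_lg ?_ ((xi_le_iff hx m).1 (by omega))))
      exact mul_pos (two_pow_sub_one_pos m.succ_pos) (by positivity)
  · have key : ∀ m, k ≤ m → m ≤ (xi x).toNat → redGivenLength x m ≤ redGivenLength x k := by
      intro m hm
      induction m, hm using Nat.le_induction with
      | base => intro _; rfl
      | succ m hm ih =>
        intro hm'
        have hm0 : 0 < m := by omega
        refine (sub_nonpos.1 ?_).trans (ih (by omega))
        rw [redGivenLength_succ_sub hx m]
        refine mul_nonpos_of_nonneg_of_nonpos hx1.le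
          (sub_nonpos.2 (lg_le_lg (two_pow_sub_one_pos hm0) ?_))
        exact (not_le.1 fun hc => absurd ((xi_le_iff hx m).2 hc) (by omega)).le
    exact key _ h le_rfl

lemma IsSource.mem_Ioo {n : ℕ} {q : Fin n → ℝ} (hq : IsSource q) (hn : 2 ≤ n) (j : Fin n) :
    q j ∈ Set.Ioo (0 : ℝ) 1 := by
  have : Nontrivial (Fin n) := Fin.nontrivial_iff_two_le.2 hn
  obtain ⟨i, hi⟩ := exists_ne j
  refine ⟨hq.pos j, ?_⟩
  rw [← hq.sum_eq_one]
  exact Finset.single_lt_sum hi (Finset.mem_univ _) (Finset.mem_univ _) (hq.pos i)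
    fun k _ _ => (hq.pos k).le

lemma avgRed_eq {n : ℕ} {q : Fin n → ℝ} (hq : ∀ i, 0 < q i) (l : Fin n → ℕ) :
    avgRed q l = ∑ i, q i * lg (q i / (2 : ℝ)⁻¹ ^ l i) := by
  refine Finset.sum_congr rfl fun i _ => ?_
  rw [inv_pow, div_inv_eq_mul, lg_mul (hq i) (by positivity), lg_two_pow, add_comm]

lemma oBar_le_avgRed {n : ℕ} (hn : 2 ≤ n) {q : Fin n → ℝ} (hq : IsSource q) {l : Fin n → ℕ}
    (hl : l ∈ lengthVectors n) (j : Fin n) : oBar (q j) ≤ avgRed q l := by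
  have : Nontrivial (Fin n) := Fin.nontrivial_iff_two_le.2 hn
  have hx := hq.mem_Ioo hn j
  refine (oBar_le_redGivenLength hx (hl.1 j)).trans ?_
  rw [redGivenLength_eq hx (hl.1 j), avgRed_eq hq.pos,
    ← Finset.add_sum_erase _ _ (Finset.mem_univ j)]
  have hs : (Finset.univ.erase j).Nonempty := by
    obtain ⟨i, hi⟩ := exists_ne j
    exact ⟨i, by simp [hi]⟩
  have h := le_sum_mul_lg_div (Finset.univ.erase j) hs q (fun i => (2 : ℝ)⁻¹ ^ l i)
    (fun i _ => hq.pos i) (fun i _ => by positivity)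
  have e1 : ∑ i ∈ Finset.univ.erase j, q i = 1 - q j := by
    rw [← hq.sum_eq_one, ← Finset.add_sum_erase _ q (Finset.mem_univ j)]; ring
  have e2 : ∑ i ∈ Finset.univ.erase j, (2 : ℝ)⁻¹ ^ l i ≤ 1 - (2 : ℝ)⁻¹ ^ l j := by
    have := hl.2
    rw [← Finset.add_sum_erase _ _ (Finset.mem_univ j)] at this
    linarith
  have hR : 0 < ∑ i ∈ Finset.univ.erase j, (2 : ℝ)⁻¹ ^ l i :=
    Finset.sum_pos (fun i _ => by positivity) hs
  rw [e1] at h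
  have hx1 : 0 < 1 - q j := by linarith [hx.2]
  have := inv_two_pow_lt_one (hl.1 j)
  gcongr
  refine le_trans (mul_le_mul_of_nonneg_left (lg_le_lg ?_ ?_) hx1.le) h
  · exact div_pos hx1 (by linarith)
  · gcongr

lemma avgRed_nonneg {n : ℕ} (hn : 2 ≤ n) {q : Fin n → ℝ} (hq : IsSource q) {l : Fin n → ℕ}
    (hl : l ∈ lengthVectors n) : 0 ≤ avgRed q l :=
  (oBar_nonneg (hq.mem_Ioo hn ⟨0, by omega⟩)).trans (oBar_le_avgRed hn hq hl _)

/-! ### Codes of small pointwise redundancy -/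

/-- The Shannon length `⌈-lg r⌉` of a symbol of probability `r`. -/
lemma exists_shannon_length {r : ℝ} (hr : r ∈ Set.Ioo (0 : ℝ) 1) :
    ∃ k : ℕ, 0 < k ∧ (k : ℤ) = ⌈-lg r⌉ ∧ (2 : ℝ)⁻¹ ^ k ≤ r ∧ k + lg r ≤ 1 := by
  have hlg := lg_neg hr.1 hr.2
  have hpos : 0 < ⌈-lg r⌉ := Int.ceil_pos.2 (by linarith)
  have hk : (⌈-lg r⌉.toNat : ℤ) = ⌈-lg r⌉ := Int.toNat_of_nonneg hpos.le
  have hkR : (⌈-lg r⌉.toNat : ℝ) = (⌈-lg r⌉ : ℝ) := by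
    exact_mod_cast congrArg (Int.cast (R := ℝ)) hk
  refine ⟨⌈-lg r⌉.toNat, by omega, hk, ?_, ?_⟩
  · have h : -lg r ≤ (⌈-lg r⌉.toNat : ℝ) := hkR ▸ Int.le_ceil _
    calc (2 : ℝ)⁻¹ ^ ⌈-lg r⌉.toNat = (2 : ℝ) ^ (-(⌈-lg r⌉.toNat : ℝ)) := by
          rw [Real.rpow_neg (by norm_num), Real.rpow_natCast, inv_pow]
      _ ≤ (2 : ℝ) ^ lg r := Real.rpow_le_rpow_of_exponent_le (by norm_num) (by linarith)
      _ = r := two_rpow_lg hr.1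
  · have := Int.ceil_lt_add_one (-lg r)
    rw [hkR]
    linarith

lemma exists_shannon_code {n : ℕ} (hn : 2 ≤ n) {q : Fin n → ℝ} (hq : IsSource q) :
    ∃ l ∈ lengthVectors n, ∀ i, (l i : ℝ) + lg (q i) ≤ 1 := by
  choose l h0 _ h1 h2 using fun i => exists_shannon_length (hq.mem_Ioo hn i)
  exact ⟨l, ⟨h0, (Finset.sum_le_sum fun i _ => h1 i).trans hq.sum_eq_one.le⟩, h2⟩

/-- The code that serves symbol `j` with its Shannon length `k` and scales the probabilities of the
other symbols to total `1 - 2⁻ᵏ` before taking Shannon lengths. -/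
lemma exists_code_le_omegaStar {n : ℕ} (hn : 2 ≤ n) {q : Fin n → ℝ} (hq : IsSource q)
    (j : Fin n) : ∃ l ∈ lengthVectors n, ∀ i, (l i : ℝ) + lg (q i) ≤ omegaStar (q j) := by
  have hx := hq.mem_Ioo hn j
  obtain ⟨k, hk0, hkc, -, -⟩ := exists_shannon_length hx
  have hx1 : 0 < 1 - q j := by linarith [hx.2]
  have hk1 : 0 < 1 - (2 : ℝ)⁻¹ ^ k := by linarith [inv_two_pow_lt_one hk0]
  set c := (1 - (2 : ℝ)⁻¹ ^ k) / (1 - q j) with hc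
  have hcpos : 0 < c := div_pos hk1 hx1
  have e1 : ∑ i ∈ Finset.univ.erase j, q i = 1 - q j := by
    rw [← hq.sum_eq_one, ← Finset.add_sum_erase _ q (Finset.mem_univ j)]; ring
  have hr : ∀ i, i ≠ j → q i * c ∈ Set.Ioo (0 : ℝ) 1 := by
    intro i hi
    refine ⟨mul_pos (hq.pos i) hcpos, ?_⟩
    have h1 : q i ≤ 1 - q j := by
      rw [← e1]
      exact Finset.single_le_sum (fun m _ => (hq.pos m).le) (by simp [hi])
    have h2 : (0 : ℝ) < (2 : ℝ)⁻¹ ^ k := by positivity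
    calc q i * c ≤ (1 - q j) * c := by gcongr
      _ = 1 - (2 : ℝ)⁻¹ ^ k := by rw [hc]; field_simp
      _ < 1 := by linarith
  choose! l h0 _ h1 h2 using fun i hi => exists_shannon_length (hr i hi)
  have hz : (2 : ℝ) ^ (-⌈-lg (q j)⌉) = (2 : ℝ)⁻¹ ^ k := by
    rw [← hkc, zpow_neg, zpow_natCast, inv_pow]
  have hkR : (⌈-lg (q j)⌉ : ℝ) = k := by rw [← hkc, Int.cast_natCast]
  refine ⟨Function.update l j k, ⟨fun i => ?_, ?_⟩, fun i => ?_⟩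
  · rcases eq_or_ne i j with rfl | hi
    · simpa using hk0
    · simpa [hi] using h0 i hi
  · rw [← Finset.add_sum_erase _ _ (Finset.mem_univ j), Function.update_self]
    have : ∑ i ∈ Finset.univ.erase j, (2 : ℝ)⁻¹ ^ Function.update l j k i
        ≤ ∑ i ∈ Finset.univ.erase j, q i * c := by
      refine Finset.sum_le_sum fun i hi => ?_
      have hi' := Finset.ne_of_mem_erase hi
      rw [Function.update_of_ne hi']
      exact h1 i hi'
    rw [← Finset.sum_mul, e1, hc, mul_div_cancel₀ _ hx1.ne'] at this
    linarith
  · rw [omegaStar, hz, hkR]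
    rcases eq_or_ne i j with rfl | hi
    · rw [Function.update_self]
      exact le_max_right _ _
    · rw [Function.update_of_ne hi]
      refine le_trans ?_ (le_max_left _ _)
      have := h2 i hi
      rw [lg_mul (hq.pos i) hcpos, hc, lg_div hk1 hx1] at this
      rw [lg_div hx1 hk1]
      linarith

lemma omegaStar_le_one {x : ℝ} (hx : x ∈ Set.Ioo (0 : ℝ) 1) : omegaStar x ≤ 1 := by
  obtain ⟨k, hk0, hkc, hkle, hk1⟩ := exists_shannon_length hx
  have hz : (2 : ℝ) ^ (-⌈-lg x⌉) = (2 : ℝ)⁻¹ ^ k := by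
    rw [← hkc, zpow_neg, zpow_natCast, inv_pow]
  have hkR : (⌈-lg x⌉ : ℝ) = k := by rw [← hkc, Int.cast_natCast]
  have hp : 0 < 1 - (2 : ℝ)⁻¹ ^ k := by linarith [inv_two_pow_lt_one hk0]
  have hx1 : 0 < 1 - x := by linarith [hx.2]
  rw [omegaStar, hz, hkR]
  refine max_le ?_ hk1
  have h := lg_le_lg (div_pos hx1 hp) ((div_le_one hp).2 (by linarith))
  rw [lg_one] at h
  linarith

lemma avgRedOpt_le_one {n : ℕ} (hn : 2 ≤ n) {q : Fin n → ℝ} (hq : IsSource q) :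
    avgRedOpt q ≤ 1 := by
  obtain ⟨l, hl, h⟩ := exists_shannon_code hn hq
  refine (csInf_le ⟨0, ?_⟩ (Set.mem_image_of_mem _ hl)).trans ?_
  · rintro _ ⟨l, hl, rfl⟩
    exact avgRed_nonneg hn hq hl
  · calc avgRed q l ≤ ∑ i, q i * 1 :=
          Finset.sum_le_sum fun i _ => mul_le_mul_of_nonneg_left (h i) (hq.pos i).le
      _ = 1 := by simpa using hq.sum_eq_one

lemma IsSource.two_le {m : ℕ} {q : Fin m → ℝ} (hq : IsSource q) {j : Fin m} (hj : q j < 1) :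
    2 ≤ m := by
  by_contra! hm
  have : Subsingleton (Fin m) := Fin.subsingleton_iff_le_one.2 (by omega)
  have := hq.sum_eq_one
  rw [Fintype.sum_subsingleton _ j] at this
  linarith

lemma one_mem_upperBounds_avgRedGivenSome {x : ℝ} (hx : x < 1) :
    1 ∈ upperBounds (avgRedGivenSome x) := by
  rintro _ ⟨m, j, q, hq, hqj, rfl⟩
  exact avgRedOpt_le_one (hq.two_le (hqj ▸ hx)) hq

lemma avgRedGivenMax_subset (x : ℝ) : avgRedGivenMax x ⊆ avgRedGivenSome x := by
  rintro _ ⟨m, hm, q, hq, hqx, rfl⟩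
  exact ⟨m, ⟨0, hm⟩, q, hq, hqx, rfl⟩

lemma one_mem_upperBounds_avgRedGivenMax {x : ℝ} (hx : x < 1) :
    1 ∈ upperBounds (avgRedGivenMax x) :=
  upperBounds_mono_set (avgRedGivenMax_subset x) (one_mem_upperBounds_avgRedGivenSome hx)

/-! ### Exponential redundancy -/

lemma expRed_eq {n : ℕ} {q : Fin n → ℝ} (hq : ∀ i, 0 < q i) (d : ℝ) (l : Fin n → ℕ) :
    expRed d q l = 1 / d * lg (∑ i, q i * (q i * 2 ^ l i) ^ d) := by
  rw [expRed]
  congr 2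
  refine Finset.sum_congr rfl fun i _ => ?_
  rw [Real.rpow_add (hq i), Real.rpow_one, Real.mul_rpow (hq i).le (by positivity),
    ← Real.rpow_natCast 2 (l i), ← Real.rpow_mul (by norm_num), mul_comm d, mul_assoc]

/-- Jensen's inequality compares average and exponential redundancy, in a direction that depends on
the sign of `d`. -/
lemma mul_avgRed_le_mul_expRed {n : ℕ} {q : Fin n → ℝ} (hq : IsSource q) {d : ℝ} (hd : d ≠ 0)
    (l : Fin n → ℕ) : d * avgRed q l ≤ d * expRed d q l := by
  have hpos : ∀ i, 0 < q i * 2 ^ l i := fun i => mul_pos (hq.pos i) (by positivity)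
  have h := sum_mul_lg_le Finset.univ q (fun i => (q i * 2 ^ l i) ^ d) (fun i _ => (hq.pos i).le)
    hq.sum_eq_one (fun i _ => Real.rpow_pos_of_pos (hpos i) d)
  have e : ∑ i, q i * lg ((q i * 2 ^ l i) ^ d) = d * avgRed q l := by
    rw [avgRed, Finset.mul_sum]
    refine Finset.sum_congr rfl fun i _ => ?_
    rw [lg_rpow (hpos i), lg_mul (hq.pos i) (by positivity), lg_two_pow]
    ring
  rw [e] at h
  rw [expRed_eq hq.pos, ← mul_assoc, mul_one_div_cancel hd, one_mul]
  exact h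

lemma expRed_le_of_forall_le {n : ℕ} {q : Fin n → ℝ} (hq : IsSource q) {d : ℝ} (hd : 0 < d)
    {l : Fin n → ℕ} {M : ℝ} (h : ∀ i, (l i : ℝ) + lg (q i) ≤ M) : expRed d q l ≤ M := by
  have hpos : ∀ i, 0 < q i * 2 ^ l i := fun i => mul_pos (hq.pos i) (by positivity)
  have hne : (Finset.univ : Finset (Fin n)).Nonempty := by
    by_contra hc
    have := hq.sum_eq_one
    rw [Finset.not_nonempty_iff_eq_empty.1 hc, Finset.sum_empty] at this
    exact zero_ne_one this
  have hle : ∑ i, q i * (q i * 2 ^ l i) ^ d ≤ ((2 : ℝ) ^ M) ^ d := by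
    calc ∑ i, q i * (q i * 2 ^ l i) ^ d ≤ ∑ i, q i * ((2 : ℝ) ^ M) ^ d := by
          refine Finset.sum_le_sum fun i _ => mul_le_mul_of_nonneg_left ?_ (hq.pos i).le
          refine Real.rpow_le_rpow (hpos i).le ?_ hd.le
          rw [← two_rpow_lg (hpos i), lg_mul (hq.pos i) (by positivity), lg_two_pow, add_comm]
          exact Real.rpow_le_rpow_of_exponent_le (by norm_num) (h i)
      _ = ((2 : ℝ) ^ M) ^ d := by rw [← Finset.sum_mul, hq.sum_eq_one, one_mul]
  have h := lg_le_lg (Finset.sum_pos (fun i _ => mul_pos (hq.pos i)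
    (Real.rpow_pos_of_pos (hpos i) d)) hne) hle
  rw [lg_rpow (by positivity), lg_two_rpow] at h
  rw [expRed_eq hq.pos, one_div, inv_mul_le_iff₀ hd]
  exact h

/-- Hölder's inequality with exponents `1 + d` and `-d`, followed by the Kraft inequality. -/
lemma expRed_nonneg_of_neg {n : ℕ} {q : Fin n → ℝ} (hq : IsSource q) {d : ℝ} (hd1 : -1 < d)
    (hd0 : d < 0) {l : Fin n → ℕ} (hl : l ∈ lengthVectors n) : 0 ≤ expRed d q l := by
  have hle : ∑ i, q i ^ (1 + d) * (2 : ℝ) ^ (d * (l i : ℝ)) ≤ 1 := by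
    calc ∑ i, q i ^ (1 + d) * (2 : ℝ) ^ (d * (l i : ℝ))
        ≤ ∑ i, ((1 + d) * q i + -d * (2 : ℝ)⁻¹ ^ l i) := by
          refine Finset.sum_le_sum fun i _ => ?_
          have e : (2 : ℝ) ^ (d * (l i : ℝ)) = ((2 : ℝ)⁻¹ ^ l i) ^ (-d) := by
            rw [inv_pow, ← Real.rpow_natCast, ← Real.rpow_neg (by norm_num),
              ← Real.rpow_mul (by norm_num)]
            congr 1
            ring
          rw [e]
          exact Real.geom_mean_le_arith_mean2_weighted (by linarith) (by linarith) (hq.pos i).le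
            (by positivity) (by ring)
      _ = (1 + d) + -d * ∑ i, (2 : ℝ)⁻¹ ^ l i := by
          rw [Finset.sum_add_distrib, ← Finset.mul_sum, ← Finset.mul_sum, hq.sum_eq_one, mul_one]
      _ ≤ (1 + d) + -d * 1 := by
          have := hl.2
          have : 0 ≤ -d := by linarith
          gcongr
      _ = 1 := by ring
  have h0 : 0 ≤ ∑ i, q i ^ (1 + d) * (2 : ℝ) ^ (d * (l i : ℝ)) :=
    Finset.sum_nonneg fun i _ => mul_nonneg (Real.rpow_nonneg (hq.pos i).le _) (by positivity)
  exact mul_nonneg_of_nonpos_of_nonpos (one_div_nonpos.2 hd0.le)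
    (Real.logb_nonpos (by norm_num) h0 hle)

lemma expRed_nonneg {n : ℕ} (hn : 2 ≤ n) {q : Fin n → ℝ} (hq : IsSource q) {d : ℝ} (hd1 : -1 < d)
    (hd0 : d ≠ 0) {l : Fin n → ℕ} (hl : l ∈ lengthVectors n) : 0 ≤ expRed d q l := by
  rcases hd0.lt_or_gt with h | h
  · exact expRed_nonneg_of_neg hq hd1 h hl
  · exact (avgRed_nonneg hn hq hl).trans
      (le_of_mul_le_mul_left (mul_avgRed_le_mul_expRed hq hd0 l) h)

lemma bddBelow_expRed {n : ℕ} (hn : 2 ≤ n) {q : Fin n → ℝ} (hq : IsSource q) {d : ℝ}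
    (hd1 : -1 < d) (hd0 : d ≠ 0) : BddBelow (expRed d q '' lengthVectors n) := by
  refine ⟨0, ?_⟩
  rintro _ ⟨l, hl, rfl⟩
  exact expRed_nonneg hn hq hd1 hd0 hl

lemma lengthVectors_nonempty {n : ℕ} (hn : 2 ≤ n) {q : Fin n → ℝ} (hq : IsSource q) :
    (lengthVectors n).Nonempty :=
  let ⟨l, hl, _⟩ := exists_shannon_code hn hq
  ⟨l, hl⟩

lemma oBar_le_expRedOpt {n : ℕ} (hn : 2 ≤ n) {q : Fin n → ℝ} (hq : IsSource q) {d : ℝ}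
    (hd : 0 < d) (j : Fin n) : oBar (q j) ≤ expRedOpt d q := by
  refine le_csInf ((lengthVectors_nonempty hn hq).image _) ?_
  rintro _ ⟨l, hl, rfl⟩
  exact (oBar_le_avgRed hn hq hl j).trans
    (le_of_mul_le_mul_left (mul_avgRed_le_mul_expRed hq hd.ne' l) hd)

lemma expRedOpt_le_omegaStar {n : ℕ} (hn : 2 ≤ n) {q : Fin n → ℝ} (hq : IsSource q) {d : ℝ}
    (hd : 0 < d) (j : Fin n) : expRedOpt d q ≤ omegaStar (q j) := by
  obtain ⟨l, hl, h⟩ := exists_code_le_omegaStar hn hq j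
  exact (csInf_le (bddBelow_expRed hn hq (by linarith) hd.ne')
    (Set.mem_image_of_mem _ hl)).trans (expRed_le_of_forall_le hq hd h)

lemma expRedOpt_nonneg {n : ℕ} (hn : 2 ≤ n) {q : Fin n → ℝ} (hq : IsSource q) {d : ℝ}
    (hd1 : -1 < d) (hd0 : d ≠ 0) : 0 ≤ expRedOpt d q := by
  refine le_csInf ((lengthVectors_nonempty hn hq).image _) ?_
  rintro _ ⟨l, hl, rfl⟩
  exact expRed_nonneg hn hq hd1 hd0 hl

lemma expRedOpt_le_avgRedOpt {n : ℕ} (hn : 2 ≤ n) {q : Fin n → ℝ} (hq : IsSource q) {d : ℝ}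
    (hd1 : -1 < d) (hd0 : d < 0) : expRedOpt d q ≤ avgRedOpt q := by
  refine le_csInf ((lengthVectors_nonempty hn hq).image _) ?_
  rintro _ ⟨l, hl, rfl⟩
  exact (csInf_le (bddBelow_expRed hn hq hd1 hd0.ne) (Set.mem_image_of_mem _ hl)).trans
    ((mul_le_mul_left_of_neg hd0).1 (mul_avgRed_le_mul_expRed hq hd0.ne l))

/-! ### The tilted source -/

lemma neg_one_lt_lg {a : ℝ} (ha : 1 / 2 < a) : -1 < lg a := by
  rw [lg, Real.lt_logb_iff_rpow_lt (by norm_num) (by linarith), Real.rpow_neg_one]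
  linarith

lemma lg_ne_zero {a : ℝ} (ha0 : 0 < a) (ha1 : a ≠ 1) : lg a ≠ 0 :=
  Real.logb_ne_zero_of_pos_of_ne_one (by norm_num) ha0 ha1

lemma order_pos {a : ℝ} (ha : 1 / 2 < a) : 0 < order a :=
  one_div_pos.2 (by linarith [neg_one_lt_lg ha])

lemma IsSource.sum_rpow_pos {n : ℕ} {p : Fin n → ℝ} (hp : IsSource p) (hn : 2 ≤ n) (r : ℝ) :
    0 < ∑ k, p k ^ r :=
  Finset.sum_pos (fun i _ => Real.rpow_pos_of_pos (hp.pos i) r) ⟨⟨0, by omega⟩, Finset.mem_univ _⟩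

lemma isSource_tilt {n : ℕ} (hn : 2 ≤ n) {p : Fin n → ℝ} (hp : IsSource p) {a : ℝ}
    (ha : 1 / 2 < a) : IsSource (tilt a p) := by
  have hS := hp.sum_rpow_pos hn (order a)
  refine ⟨fun i => div_pos (Real.rpow_pos_of_pos (hp.pos i) _) hS, ?_, fun i j hij => ?_⟩
  · simp only [tilt]
    rw [← Finset.sum_div, div_self hS.ne']
  · exact div_le_div_of_nonneg_right
      (Real.rpow_le_rpow (hp.pos j).le (hp.antitone hij) (order_pos ha).le) hS.le

lemma one_sub_order {a : ℝ} (ha : 1 / 2 < a) : 1 - order a = lg a / (1 + lg a) := by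
  have : 1 + lg a ≠ 0 := by linarith [neg_one_lt_lg ha]
  rw [order]
  field_simp
  ring

lemma tilt_eq {n : ℕ} (hn : 2 ≤ n) {p : Fin n → ℝ} (hp : IsSource p) {a : ℝ}
    (ha : 1 / 2 < a) (ha1 : a ≠ 1) (j : Fin n) :
    tilt a p j = p j ^ order a * (2 : ℝ) ^ ((order a - 1) * renyi (order a) p) := by
  have hS := hp.sum_rpow_pos hn (order a)
  have h0 : 1 - order a ≠ 0 := by
    rw [one_sub_order ha]
    exact div_ne_zero (lg_ne_zero (by linarith) ha1) (by linarith [neg_one_lt_lg ha])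
  have e : (order a - 1) * renyi (order a) p = -lg (∑ k, p k ^ order a) := by
    rw [renyi]
    field_simp
    ring
  rw [e, Real.rpow_neg (by norm_num), two_rpow_lg hS, tilt, div_eq_mul_inv]

lemma expRed_tilt {n : ℕ} (hn : 2 ≤ n) {p : Fin n → ℝ} (hp : IsSource p) {a : ℝ}
    (ha : 1 / 2 < a) (ha1 : a ≠ 1) (l : Fin n → ℕ) :
    expRed (lg a) (tilt a p) l = expCost a p l - renyi (order a) p := by
  have hS := hp.sum_rpow_pos hn (order a)
  have ha0 : 0 < a := by linarith
  have hd : 1 + lg a ≠ 0 := by linarith [neg_one_lt_lg ha]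
  have hd0 := lg_ne_zero ha0 ha1
  have hC : 0 < ∑ i, p i * a ^ l i :=
    Finset.sum_pos (fun i _ => mul_pos (hp.pos i) (by positivity))
      ⟨⟨0, by omega⟩, Finset.mem_univ _⟩
  have e : ∑ i, tilt a p i ^ (1 + lg a) * (2 : ℝ) ^ (lg a * (l i : ℝ)) =
      (∑ i, p i * a ^ l i) / (∑ k, p k ^ order a) ^ (1 + lg a) := by
    rw [Finset.sum_div]
    refine Finset.sum_congr rfl fun i _ => ?_
    rw [tilt, Real.div_rpow (Real.rpow_nonneg (hp.pos i).le _) hS.le, ← Real.rpow_mul (hp.pos i).le,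
      order, one_div_mul_cancel hd, Real.rpow_one, Real.rpow_mul (by norm_num), two_rpow_lg ha0,
      Real.rpow_natCast]
    ring
  have ec : expCost a p l = lg (∑ i, p i * a ^ l i) / lg a := by
    rw [expCost, lg, lg, Real.logb, Real.logb, Real.logb]
    have : Real.log 2 ≠ 0 := (Real.log_pos (by norm_num)).ne'
    field_simp
  rw [expRed, e, lg_div hC (Real.rpow_pos_of_pos hS _), lg_rpow hS, ec, renyi, one_sub_order ha]
  field_simp

lemma expRedOpt_tilt {n : ℕ} (hn : 2 ≤ n) {p : Fin n → ℝ} (hp : IsSource p) {a : ℝ}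
    (ha : 1 / 2 < a) (ha1 : a ≠ 1) :
    expRedOpt (lg a) (tilt a p) = expCostOpt a p - renyi (order a) p := by
  have hq := isSource_tilt hn hp ha
  have hb := bddBelow_expRed hn hq (neg_one_lt_lg ha) (lg_ne_zero (by linarith) ha1)
  have hne := (lengthVectors_nonempty hn hp).image (expRed (lg a) (tilt a p))
  have e : expCost a p '' lengthVectors n =
      OrderIso.addRight (renyi (order a) p) '' (expRed (lg a) (tilt a p) '' lengthVectors n) := by
    rw [Set.image_image]
    refine Set.image_congr fun l _ => ?_
    rw [expRed_tilt hn hp ha ha1, OrderIso.addRight_apply, sub_add_cancel]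
  rw [expCostOpt, e, ← OrderIso.map_csInf' _ hne hb, OrderIso.addRight_apply, add_sub_cancel_right,
    expRedOpt]

end ExpCoding

end

theorem corollary2 :
    -- the lower bound is nonnegative and the upper bounds are at most one bit
    (∀ x ∈ Set.Ioo (0 : ℝ) 1, 0 ≤ oBar x ∧ omegaStar x ≤ 1 ∧ omegaBar x ≤ 1 ∧ omegaBar' x ≤ 1) ∧
    ∀ (n : ℕ) (hn : 2 ≤ n) (p : Fin n → ℝ), IsSource p →
    ∀ a : ℝ, 1 / 2 < a → a ≠ 1 →
      -- the transformation to exponential redundancy with parameter `lg a`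
      (IsSource (tilt a p) ∧
        (∀ j, tilt a p j = p j ^ order a * (2 : ℝ) ^ ((order a - 1) * renyi (order a) p)) ∧
        (∀ l ∈ lengthVectors n, expRed (lg a) (tilt a p) l = expCost a p l - renyi (order a) p) ∧
        expRedOpt (lg a) (tilt a p) = expCostOpt a p - renyi (order a) p) ∧
      -- growing exponentials
      (1 < a → ∀ j : Fin n,
        oBar (p j ^ order a * (2 : ℝ) ^ ((order a - 1) * renyi (order a) p))
            ≤ expCostOpt a p - renyi (order a) p ∧
        expCostOpt a p - renyi (order a) p
            ≤ omegaStar (p j ^ order a * (2 : ℝ) ^ ((order a - 1) * renyi (order a) p))) ∧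
      -- decaying exponentials
      (a < 1 →
        0 ≤ expCostOpt a p - renyi (order a) p ∧
        expCostOpt a p - renyi (order a) p
            ≤ omegaBar (p ⟨0, by omega⟩ ^ order a *
                (2 : ℝ) ^ ((order a - 1) * renyi (order a) p)) ∧
        (∀ j : Fin n, expCostOpt a p - renyi (order a) p
            ≤ omegaBar' (p j ^ order a * (2 : ℝ) ^ ((order a - 1) * renyi (order a) p))) ∧
        (∀ ω : ℝ → ℝ, IsUpperBoundGivenMax ω →
          expCostOpt a p - renyi (order a) p
            ≤ ω (p ⟨0, by omega⟩ ^ order a *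
                (2 : ℝ) ^ ((order a - 1) * renyi (order a) p))) ∧
        (∀ ω' : ℝ → ℝ, IsUpperBoundGivenSome ω' → ∀ j : Fin n,
          expCostOpt a p - renyi (order a) p
            ≤ ω' (p j ^ order a * (2 : ℝ) ^ ((order a - 1) * renyi (order a) p)))) := by
  refine ⟨fun x hx => ⟨oBar_nonneg hx, omegaStar_le_one hx,
    Real.sSup_le (fun r hr => one_mem_upperBounds_avgRedGivenMax hx.2 hr) zero_le_one,
    Real.sSup_le (fun r hr => one_mem_upperBounds_avgRedGivenSome hx.2 hr) zero_le_one⟩, ?_⟩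
  intro n hn p hp a ha ha1
  have hq := isSource_tilt hn hp ha
  have hd1 := neg_one_lt_lg ha
  -- All claims now concern the source `tilt a p` and its optimal exponential redundancy.
  simp only [← tilt_eq hn hp ha ha1, ← expRedOpt_tilt hn hp ha ha1]
  refine ⟨⟨hq, fun _ => trivial, fun l _ => expRed_tilt hn hp ha ha1 l, trivial⟩, fun h j =>
    ⟨oBar_le_expRedOpt hn hq (lg_pos h) j, expRedOpt_le_omegaStar hn hq (lg_pos h) j⟩, fun h => ?_⟩
  have hd0 : lg a < 0 := lg_neg (by linarith) h
  have hle := expRedOpt_le_avgRedOpt hn hq hd1 hd0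
  have hmax : avgRedOpt (tilt a p) ∈ avgRedGivenMax (tilt a p ⟨0, by omega⟩) :=
    ⟨n, by omega, _, hq, rfl, rfl⟩
  have hsome : ∀ j, avgRedOpt (tilt a p) ∈ avgRedGivenSome (tilt a p j) :=
    fun j => ⟨n, j, _, hq, rfl, rfl⟩
  exact ⟨expRedOpt_nonneg hn hq hd1 hd0.ne,
    hle.trans (le_csSup ⟨1, one_mem_upperBounds_avgRedGivenMax (hq.mem_Ioo hn _).2⟩ hmax),
    fun j => hle.trans
      (le_csSup ⟨1, one_mem_upperBounds_avgRedGivenSome (hq.mem_Ioo hn j).2⟩ (hsome j)),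
    fun ω hω => hle.trans (hω _ (hq.mem_Ioo hn _) hmax),
    fun ω' hω' j => hle.trans (hω' _ (hq.mem_Ioo hn j) (hsome j))⟩
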